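/- Let $d\ge 1$ and let $\mathbb{R}^d$ carry its Borel $\sigma$-field. Let $K$ (resp. $\widetilde K$) be a transition kernel on $\mathbb{R}^d$ with a unique stationary distribution $\mu_K$ (resp. $\mu_{\widetilde K}$). Define the law of two consecutive states by $R_K(E)=\int \mu_K(dx)\,K(x,dy)\,\mathbf 1_E(x,y)$ for Borel $E\subset\mathbb{R}^{2d}$, and for $z_1,z_2\in\mathbb{C}^d$ put $\Phi_{R_K}(z_1,z_2)=\int \exp(z_1^Tx_1+z_2^Tx_2)\,dR_K(x_1,x_2)$; define $R_{\widetilde K}$ and $\Phi_{R_{\widetilde K}}$ in the same way from $\widetilde K$. For a probability measure $P$ on $\mathbb{R}^d$ let $\mathbb{P}_{K,P}$ be the law of the sequence $(Y_i)_{i\ge1}$, $Y_i=X_i+\varepsilon_i$, where $(X_i)_{i\ge1}$ is the stationary Markov chain with transition kernel $K$ (so $X_1\sim\mu_K$) and $(\varepsilon_i)_{i\ge1}$ is an i.i.d. sequence of law $P$, independent of $(X_i)_{i\ge1}$. For $\rho>0$ let $\mathcal{M}_\rho$ be the set of finite measures $\mu$ on $\mathbb{R}^d$ for which there exist $A,B>0$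 such that $\int \exp(u^Tx)\,d\mu(x)\le A\exp(B\|u\|^\rho)$ for all $u\in\mathbb{R}^d$, where $\|\cdot\|$ is the Euclidean norm. Assume that there exists $\rho\in(0,2)$ such that $\mu_K\in\mathcal{M}_\rho$ and $\mu_{\widetilde K}\in\mathcal{M}_\rho$, and that both $R=R_K$ and $R=R_{\widetilde K}$ satisfy the following dependency assumption: for every $z_0\in\mathbb{C}^d$, the function $z\mapsto\Phi_R(z_0,z)$ is not identically zero on $\mathbb{C}^d$ or the function $z\mapsto\Phi_R(z,z_0)$ is not identically zero on $\mathbb{C}^d$. Let $P$ and $\widetilde P$ be arbitrary probability measures on $\mathbb{R}^d$. If $\mathbb{P}_{K,P}=\mathbb{P}_{\widetilde K,\widetilde P}$, then $R_K=R_{\widetilde K}$ and $P=\widetilde P$ up to translation, that is, there exists $m\in\mathbb{R}^d$ such that, if $(X_1,X_2)$ has law $R_K$ and $(\varepsilon_1,\varepsilon_2)$ has law $P\otimes P$, then $(X_1-m,X_2-m)$ has law $R_{\widetilde K}$ and $(\varepsilon_1+m,\varepsilon_2+m)$ has law $\widetilde P\otimes\widetilde P$. -/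

import Mathlib

open MeasureTheory ProbabilityTheory

noncomputable section

namespace TranslationHMM

/-- `ℝ^d` with its Euclidean norm and Borel sigma-field. -/
abbrev State (d : ℕ) : Type := EuclideanSpace ℝ (Fin d)

/-- `μ` is the unique stationary distribution of the transition kernel `K`. -/
def IsUniqueStationary {d : ℕ} (K : Kernel (State d) (State d)) (μ : Measure (State d)) : Prop :=
  IsProbabilityMeasure μ ∧ Kernel.Invariant K μ ∧
    ∀ ν : Measure (State d), IsProbabilityMeasure ν → Kernel.Invariant K ν → ν = μ

/-- The law of two consecutive states: `R(E) = ∫ μ(dx) K(x, dy) 1_E(x, y)`. -/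
def pairLaw {d : ℕ} (K : Kernel (State d) (State d)) (μ : Measure (State d)) :
    Measure (State d × State d) :=
  μ ⊗ₘ K

/-- The law, on sequences indexed by `0, 1, 2, …`, of the Markov chain with initial law `μ` and
transition kernel `K`: given the first `n + 1` states, the next one is drawn from `K` at
the last of them. -/
def chainLaw {d : ℕ} (K : Kernel (State d) (State d)) [IsMarkovKernel K]
    (μ : Measure (State d)) : Measure (ℕ → State d) :=
  Kernel.trajMeasure (X := fun _ => State d) μ
    (fun n => K.comap (fun x : (i : Finset.Iic n) → State d => x ⟨n, Finset.mem_Iic.2 le_rfl⟩)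
      (measurable_pi_apply _))

/-- The law of the observations `Y i = X i + ε i`, where `X` is the Markov chain with initial law
`μ` and transition kernel `K`, and `ε` is an i.i.d. sequence of law `P`, independent of `X`. -/
def obsLaw {d : ℕ} (K : Kernel (State d) (State d)) [IsMarkovKernel K]
    (μ : Measure (State d)) (P : Measure (State d)) [IsProbabilityMeasure P] :
    Measure (ℕ → State d) :=
  ((chainLaw K μ).prod (Measure.infinitePi (fun _ : ℕ => P))).map
    (fun p : (ℕ → State d) × (ℕ → State d) => fun i => p.1 i + p.2 i)

/-- The finite measures `μ` on `ℝ^d` for which there are `A, B > 0` with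
`∫ exp (uᵀ x) μ(dx) ≤ A exp (B ‖u‖ ^ ρ)` for all `u`. -/
def expClass (d : ℕ) (ρ : ℝ) : Set (Measure (State d)) :=
  {μ | IsFiniteMeasure μ ∧ ∃ A B : ℝ, 0 < A ∧ 0 < B ∧ ∀ u : State d,
    ∫⁻ x, ENNReal.ofReal (Real.exp (inner ℝ u x)) ∂μ
      ≤ ENNReal.ofReal (A * Real.exp (B * ‖u‖ ^ ρ))}

/-- `Φ_R(z₁, z₂) = ∫ exp (z₁ᵀ x₁ + z₂ᵀ x₂) R(dx₁, dx₂)` for `z₁, z₂ ∈ ℂ^d`. -/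
def Phi {d : ℕ} (R : Measure (State d × State d)) (z₁ z₂ : Fin d → ℂ) : ℂ :=
  ∫ x, Complex.exp ((∑ j, z₁ j * (x.1 j : ℂ)) + ∑ j, z₂ j * (x.2 j : ℂ)) ∂(R)

/-- The dependency assumption: for every `z₀`, at least one of `Φ_R(z₀, ·)` and `Φ_R(·, z₀)` is
not the null function. -/
def DependencyAssumption {d : ℕ} (R : Measure (State d × State d)) : Prop :=
  ∀ z₀ : Fin d → ℂ, (fun z => Phi R z₀ z) ≠ 0 ∨ (fun z => Phi R z z₀) ≠ 0

/-- `R = R'` and `P = P'` up to translation: for some `m`, the law of `(X₁ - m, X₂ - m)` is `R'`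
if `(X₁, X₂)` has law `R`, and the law of `(ε₁ + m, ε₂ + m)` is `P' ⊗ P'` if `(ε₁, ε₂)`
has law `P ⊗ P`. -/
def EqUpToTranslation {d : ℕ} (R R' : Measure (State d × State d))
    (P P' : Measure (State d)) : Prop :=
  ∃ m : State d,
    R.map (fun x => (x.1 - m, x.2 - m)) = R' ∧
    (P.prod P).map (fun e => (e.1 + m, e.2 + m)) = P'.prod P'

end TranslationHMM

end

/-!
Write `Φ`, `Φ'` for the Laplace transforms of the laws of two consecutive states, `L`, `L'` for those
of the stationary distributions and `φ`, `φ'` for the characteristic functions of the noise. The laws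
of one and of two consecutive observations give, on imaginary vectors, `L φ = L' φ'` and
`Φ (z₁, z₂) φ φ = Φ' (z₁, z₂) φ' φ'`. Near the origin `φ` does not vanish and can be eliminated:
`Φ (z₁, z₂) L'(z₁) L'(z₂) = Φ' (z₁, z₂) L(z₁) L(z₂)`. All functions in this identity are entire, so
it holds for all complex vectors (`Phi_mul_laplace_eq`).

The dependency assumption now forces `L` and `L'` to have the same zeros with the same
multiplicities on every complex line through the origin (`analyticOrderAt_laplace_le`): wherever
`Φ'` can be made nonzero by the choice of the other variable, the identity shows that `L'` divides
`L` locally, and conversely.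

Hence, on the complexification of each real line, `L = G L'` with `G` entire and zero-free. Both
functions have order at most `ρ < 2`. Jensen's formula bounds the circle means of `|log ‖L‖|` and
`|log ‖L'‖|`, hence those of `|log ‖G‖|`, by a multiple of `R ^ ρ`; the Poisson integral, the
Borel-Carathéodory theorem and Cauchy's estimate then show that `log G` is linear
(`exists_eq_exp_mul_of_factor`). Its slope is the derivative of `L / L'` at the origin, that is, the
pairing of the direction with the difference `m` of the means (`laplace_smul_eq_exp_mul`).

Substituting `L(z) = exp (zᵀ m) L'(z)` and cancelling `L'`, which vanishes on no open set, gives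
`Φ (z₁, z₂) = exp ((z₁ + z₂)ᵀ m) Φ' (z₁, z₂)` and `φ(t) exp (i tᵀ m) = φ'(t)`
(`eqUpToTranslation_of_charFun`).
-/

/-! ### Zero-free quotients of entire functions of order less than two -/

section ComplexAnalysis

open Complex Metric Filter Topology Real

/-- Since `|x| = 2 max x 0 - x`, Jensen's formula turns an upper bound for an entire function
normalized at the origin into a bound for the mean of `|log ‖f‖|`. -/
theorem circleAverage_abs_log_norm_le {f : ℂ → ℂ} (hf : Differentiable ℂ f) (hf0 : f 0 = 1)
    {R M : ℝ} (hR : 0 < R) (hM : 0 ≤ M) (hb : ∀ z ∈ sphere (0 : ℂ) R, ‖f z‖ ≤ Real.exp M) :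
    circleAverage (fun z => |Real.log ‖f z‖|) 0 R ≤ 2 * M := by
  have han : AnalyticOnNhd ℂ f Set.univ := hf.differentiableOn.analyticOnNhd isOpen_univ
  have hci : CircleIntegrable (fun z => Real.log ‖f z‖) 0 R :=
    (han.mono (Set.subset_univ _)).meromorphicOn.circleIntegrable_log_norm
  have hjensen : 0 ≤ circleAverage (fun z => Real.log ‖f z‖) 0 R := by
    rw [AnalyticOnNhd.circleAverage_log_norm hR.ne' (han.mono (Set.subset_univ _)) (by simp [hf0])]
    simp only [hf0, norm_one, Real.log_one, add_zero]
    refine finsum_nonneg fun u => ?_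
    by_cases hu : u ∈ closedBall (0 : ℂ) |R|
    · have h1 : 0 ≤ MeromorphicOn.divisor f (closedBall 0 |R|) u :=
        (MeromorphicOn.AnalyticOnNhd.divisor_nonneg (han.mono (Set.subset_univ _))) u
      have h2 : 0 ≤ Real.log (R * ‖0 - u‖⁻¹) := by
        rcases eq_or_ne u 0 with rfl | h0
        · simp
        · apply Real.log_nonneg
          rw [← div_eq_mul_inv, one_le_div (by simpa using h0)]
          simpa [abs_of_pos hR] using hu
      have h3 : (0 : ℝ) ≤ (MeromorphicOn.divisor f (closedBall 0 |R|) u : ℝ) := by exact_mod_cast h1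
      positivity
    · simp [Function.locallyFinsuppWithin.apply_eq_zero_of_notMem _ hu]
  have hle : circleAverage (fun z => |Real.log ‖f z‖|) 0 R
      ≤ circleAverage (fun z => 2 * M - Real.log ‖f z‖) 0 R := by
    apply circleAverage_mono hci.abs ((circleIntegrable_const _ _ _).sub hci)
    intro z hz
    rw [abs_of_pos hR] at hz
    have : Real.log ‖f z‖ ≤ M := by
      rcases eq_or_ne (f z) 0 with h0 | h0
      -- here `log ‖f z‖ = log 0 = 0`
      · simpa [h0] using hM
      · exact (Real.log_le_iff_le_exp (norm_pos_iff.2 h0)).2 (hb z hz)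
    change |Real.log ‖f z‖| ≤ 2 * M - Real.log ‖f z‖
    rw [abs_le]; constructor <;> linarith
  rw [circleAverage_fun_sub (circleIntegrable_const _ _ _) hci, circleAverage_const] at hle
  linarith

/-- If `f = exp Q * h`, then `Re Q = log ‖f‖ - log ‖h‖` away from the zeros of `h`, so the means of
`|log ‖f‖|` and `|log ‖h‖|` bound that of `|Re Q|`, and the Poisson integral makes the bound
pointwise. This replaces a lower bound for `‖h‖`. -/
theorem re_le_of_eq_exp_mul {f h Q : ℂ → ℂ} (hf : Differentiable ℂ f) (hh : Differentiable ℂ h)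
    (hQ : Differentiable ℂ Q) (hf0 : f 0 = 1) (hh0 : h 0 = 1)
    (hfac : ∀ z, f z = Complex.exp (Q z) * h z) {R M : ℝ} (hR : 0 < R) (hM : 0 ≤ M)
    (hfb : ∀ z ∈ sphere (0 : ℂ) R, ‖f z‖ ≤ Real.exp M)
    (hhb : ∀ z ∈ sphere (0 : ℂ) R, ‖h z‖ ≤ Real.exp M) {w : ℂ} (hw : ‖w‖ ≤ R / 2) :
    (Q w).re ≤ 12 * M := by
  have hwb : w ∈ ball (0 : ℂ) R := by
    rw [mem_ball_zero_iff]; linarith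
  set k : ℂ → ℝ := fun z => (herglotzRieszKernel 0 w z).re with hk
  have hkc : ContinuousOn k (sphere 0 |R|) :=
    Complex.continuous_re.comp_continuousOn (continuousOn_herglotzRieszKernel_sphere hwb)
  have hP : circleAverage (k • Q) 0 R = Q w :=
    DiffContOnCl.circleAverage_re_herglotzRieszKernel_smul hQ.diffContOnCl hwb
  have hPi : CircleIntegrable (k • Q) 0 R :=
    ContinuousOn.circleIntegrable' (hkc.smul hQ.continuous.continuousOn)
  have hre : circleAverage (fun z => k z * (Q z).re) 0 R = (Q w).re := by
    rw [← hP]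
    have := ContinuousLinearMap.circleAverage_comp_comm Complex.reCLM hPi
    rw [← Complex.reCLM_apply, ← this]
    congr 1
    ext z
    simp
  have hanf : AnalyticOnNhd ℂ f Set.univ := hf.differentiableOn.analyticOnNhd isOpen_univ
  have hanh : AnalyticOnNhd ℂ h Set.univ := hh.differentiableOn.analyticOnNhd isOpen_univ
  have hcf : CircleIntegrable (fun z => |Real.log ‖f z‖|) 0 R :=
    ((hanf.mono (Set.subset_univ _)).meromorphicOn.circleIntegrable_log_norm).abs
  have hch : CircleIntegrable (fun z => |Real.log ‖h z‖|) 0 R :=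
    ((hanh.mono (Set.subset_univ _)).meromorphicOn.circleIntegrable_log_norm).abs
  have habs : circleAverage (fun z => |(Q z).re|) 0 R ≤ 4 * M := by
    have hcong : circleAverage (fun z => |(Q z).re|) 0 R
        = circleAverage (fun z => |Real.log ‖f z‖ - Real.log ‖h z‖|) 0 R := by
      refine circleAverage_congr_codiscreteWithin ?_ hR.ne'
      have hmem : h ⁻¹' {0}ᶜ ∈ codiscreteWithin (sphere (0 : ℂ) |R|) :=
        codiscreteWithin_mono (Set.subset_univ _)
          (hanh.preimage_zero_mem_codiscrete (x := 0) (by simp [hh0]))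
      filter_upwards [hmem] with z hz
      have hz' : h z ≠ 0 := hz
      rw [hfac z, norm_mul, Complex.norm_exp, Real.log_mul (Real.exp_ne_zero _)
        (norm_ne_zero_iff.2 hz'), Real.log_exp, add_sub_cancel_right]
    rw [hcong]
    have hle : circleAverage (fun z => |Real.log ‖f z‖ - Real.log ‖h z‖|) 0 R
        ≤ circleAverage (fun z => |Real.log ‖f z‖| + |Real.log ‖h z‖|) 0 R := by
      apply circleAverage_mono _ (hcf.add hch)
      · intro z _
        exact abs_sub _ _
      · exact ((((hanf.mono (Set.subset_univ _)).meromorphicOn.circleIntegrable_log_norm)).sub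
          (((hanh.mono (Set.subset_univ _)).meromorphicOn.circleIntegrable_log_norm))).abs
    rw [circleAverage_fun_add hcf hch] at hle
    have h1 := circleAverage_abs_log_norm_le hf hf0 hR hM hfb
    have h2 := circleAverage_abs_log_norm_le hh hh0 hR hM hhb
    linarith
  have hcQ : CircleIntegrable (fun z => |(Q z).re|) 0 R := by
    apply ContinuousOn.circleIntegrable'
    have := hQ.continuous
    fun_prop
  have hle3 : (Q w).re ≤ circleAverage (fun z => (3 : ℝ) • |(Q z).re|) 0 R := by
    rw [← hre]
    apply circleAverage_mono
    · apply ContinuousOn.circleIntegrable'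
      have := hQ.continuous
      fun_prop
    · exact hcQ.const_mul 3
    intro z hz
    rw [abs_of_pos hR] at hz
    -- the kernel is at most `(R + ‖w‖) / (R - ‖w‖)`, which is at most `3` for `‖w‖ ≤ R / 2`
    have hub : k z ≤ 3 := by
      have := re_herglotzRieszKernel_le hz hwb
      simp only [sub_zero] at this
      simp only [hk, herglotzRieszKernel_def, sub_zero]
      refine this.trans ?_
      rw [div_le_iff₀ (by linarith)]
      linarith
    have hlb : 0 ≤ k z := by
      have := le_re_herglotzRieszKernel hz hwb
      simp only [sub_zero] at this
      simp only [hk, herglotzRieszKernel_def, sub_zero]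
      refine le_trans ?_ this
      apply div_nonneg
      · linarith
      · positivity
    calc k z * (Q z).re ≤ k z * |(Q z).re| := by gcongr; exact le_abs_self _
      _ ≤ (3 : ℝ) • |(Q z).re| := by rw [smul_eq_mul]; gcongr
  rw [circleAverage_fun_smul] at hle3
  simp only [smul_eq_mul] at hle3
  linarith

/-- A Hadamard-type theorem: the zero-free quotient of two entire functions of order less than two
is the exponential of a linear function. -/
theorem exists_eq_exp_mul_of_factor {f h G : ℂ → ℂ} (hf : Differentiable ℂ f)
    (hh : Differentiable ℂ h) (hG : Differentiable ℂ G) (hG0 : ∀ z, G z ≠ 0)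
    (hf0 : f 0 = 1) (hh0 : h 0 = 1) (hfac : ∀ z, f z = G z * h z)
    {ρ A B : ℝ} (hρ : ρ < 2) (hB : 0 ≤ B)
    (hfb : ∀ z, ‖f z‖ ≤ A * Real.exp (B * ‖z‖ ^ ρ))
    (hhb : ∀ z, ‖h z‖ ≤ A * Real.exp (B * ‖z‖ ^ ρ)) :
    ∃ a : ℂ, ∀ z, f z = Complex.exp (a * z) * h z := by
  -- a logarithm of `G`
  have hG'd : Differentiable ℂ (deriv G) := fun z =>
    ((hG.analyticAt z).deriv).differentiableAt
  obtain ⟨Q, hQ0, hQd⟩ := ((hG'd.div hG hG0).isExactOn_univ).with_val_at 0 0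
  have hQ : Differentiable ℂ Q := fun z => (hQd z trivial).differentiableAt
  have hGQ : ∀ z, G z = Complex.exp (Q z) := by
    have hd : ∀ z, HasDerivAt (fun z => G z * Complex.exp (-Q z)) 0 z := by
      intro z
      have h1 := ((hG z).hasDerivAt).mul ((hQd z trivial).neg.cexp)
      refine h1.congr_deriv ?_
      have := hG0 z
      change deriv G z * Complex.exp (-Q z) + G z * (Complex.exp (-Q z) * -(deriv G z / G z)) = 0
      field_simp
      ring
    intro z
    have hc := is_const_of_deriv_eq_zero (fun z => (hd z).differentiableAt)
      (fun z => (hd z).deriv) z 0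
    have hG00 : G 0 = 1 := by simpa [hf0, hh0] using (hfac 0).symm
    simp only [hG00, hQ0, neg_zero, Complex.exp_zero, mul_one] at hc
    rw [Complex.exp_neg] at hc
    field_simp at hc
    exact hc
  have hfac' : ∀ z, f z = Complex.exp (Q z) * h z := fun z => by rw [hfac, hGQ]
  -- the summand `1` makes the bound strictly positive, as the Borel-Carathéodory theorem requires
  set M : ℝ → ℝ := fun R => Real.log (max A 1) + 1 + B * R ^ ρ with hMdef
  have hMpos : ∀ R, 0 ≤ R → 0 < M R := by
    intro R hR
    have : 0 ≤ Real.log (max A 1) := Real.log_nonneg (le_max_right _ _)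
    have : 0 ≤ B * R ^ ρ := by positivity
    simp only [hMdef]
    linarith
  have hbound : ∀ R, A * Real.exp (B * R ^ ρ) ≤ Real.exp (M R) := by
    intro R
    have hA : A ≤ Real.exp (Real.log (max A 1) + 1) := by
      calc A ≤ max A 1 := le_max_left _ _
        _ = Real.exp (Real.log (max A 1)) := (Real.exp_log (by positivity)).symm
        _ ≤ _ := by gcongr; linarith
    rw [hMdef, Real.exp_add]
    gcongr
  have hre : ∀ R, 0 < R → ∀ w, ‖w‖ ≤ R / 2 → (Q w).re ≤ 12 * M R := by
    intro R hR w hw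
    refine re_le_of_eq_exp_mul hf hh hQ hf0 hh0 hfac' hR (hMpos R hR.le).le ?_ ?_ hw
    · intro z hz
      have : ‖z‖ = R := by simpa using hz
      exact (this ▸ hfb z).trans (hbound R)
    · intro z hz
      have : ‖z‖ = R := by simpa using hz
      exact (this ▸ hhb z).trans (hbound R)
  have hnorm : ∀ R, 0 < R → ∀ w, ‖w‖ ≤ R / 4 → ‖Q w‖ ≤ 24 * M R := by
    intro R hR w hw
    have h1 := borelCaratheodory_zero (f := Q) (M := 12 * M R) (R := R / 2) (z := w)
      (by have := hMpos R hR.le; positivity) hQ.differentiableOn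
      (fun z hz => hre R hR z (by simpa using (mem_ball_zero_iff.1 hz).le)) (by positivity)
      (by rw [mem_ball_zero_iff]; linarith) hQ0
    refine h1.trans ?_
    rw [div_le_iff₀ (by linarith)]
    have := hMpos R hR.le
    nlinarith
  -- Cauchy's estimate on the circle of radius `R / 8` around `c`, which lies in `‖z‖ ≤ R / 4`
  have hQ2 : ∀ c, iteratedDeriv 2 Q c = 0 := by
    intro c
    have hev : ∀ᶠ R : ℝ in atTop, ‖iteratedDeriv 2 Q c‖
        ≤ 3072 * ((Real.log (max A 1) + 1) * R ^ (-2 : ℝ) + B * R ^ (-(2 - ρ))) := by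
      filter_upwards [eventually_gt_atTop 0, eventually_ge_atTop (8 * ‖c‖)] with R hR hRc
      have h1 := norm_iteratedDeriv_le_of_forall_mem_sphere_norm_le (c := c) (R := R / 8)
        (C := 24 * M R) (f := Q) 2 (by positivity) hQ.diffContOnCl (by
          intro z hz
          apply hnorm R hR
          rw [mem_sphere_iff_norm] at hz
          calc ‖z‖ = ‖(z - c) + c‖ := by simp
            _ ≤ ‖z - c‖ + ‖c‖ := norm_add_le _ _
            _ ≤ R / 4 := by linarith)
      refine h1.trans (le_of_eq ?_)
      have e1 : R ^ (-2 : ℝ) = 1 / R ^ 2 := by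
        rw [Real.rpow_neg hR.le]; simp
      have e2 : R ^ (-(2 - ρ)) = R ^ ρ / R ^ 2 := by
        rw [neg_sub, Real.rpow_sub hR]; simp
      rw [e1, e2, hMdef]
      simp only [Nat.factorial]
      field_simp
      norm_num
      ring
    have hlim : Tendsto (fun R : ℝ => 3072 * ((Real.log (max A 1) + 1) * R ^ (-2 : ℝ)
        + B * R ^ (-(2 - ρ)))) atTop (𝓝 0) := by
      have t1 := tendsto_rpow_neg_atTop (y := 2) (by norm_num)
      have t2 := tendsto_rpow_neg_atTop (y := 2 - ρ) (by linarith)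
      simpa using ((t1.const_mul (Real.log (max A 1) + 1)).add (t2.const_mul B)).const_mul 3072
    have := ge_of_tendsto hlim hev
    exact norm_le_zero_iff.1 this
  have hQ'd : Differentiable ℂ (deriv Q) := fun z => ((hQ.analyticAt z).deriv).differentiableAt
  have hQ' : ∀ z, deriv Q z = deriv Q 0 := fun z =>
    is_const_of_deriv_eq_zero hQ'd (fun z => by
      have := hQ2 z
      rwa [iteratedDeriv_succ, iteratedDeriv_one] at this) z 0
  have hQlin : ∀ z, Q z = deriv Q 0 * z := by
    intro z
    have hd : ∀ z, HasDerivAt (fun z => Q z - deriv Q 0 * z) 0 z := by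
      intro z
      have := ((hQ z).hasDerivAt).sub ((hasDerivAt_id z).const_mul (deriv Q 0))
      simpa [hQ' z] using! this
    have hc := is_const_of_deriv_eq_zero (fun z => (hd z).differentiableAt)
      (fun z => (hd z).deriv) z 0
    simp only [hQ0, mul_zero, sub_zero] at hc
    exact sub_eq_zero.1 hc
  exact ⟨deriv Q 0, fun z => by rw [hfac', hQlin]⟩

/-- Two entire functions with the same zeros, counted with multiplicity, differ by a zero-free
entire factor. -/
theorem exists_entire_factor {f h : ℂ → ℂ} (hf : Differentiable ℂ f) (hh : Differentiable ℂ h)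
    (hh0 : h 0 ≠ 0)
    (hord : ∀ z, analyticOrderAt f z = analyticOrderAt h z) :
    ∃ G : ℂ → ℂ, Differentiable ℂ G ∧ (∀ z, G z ≠ 0) ∧ ∀ z, f z = G z * h z := by
  have hanf : AnalyticOnNhd ℂ f Set.univ := hf.differentiableOn.analyticOnNhd isOpen_univ
  have hanh : AnalyticOnNhd ℂ h Set.univ := hh.differentiableOn.analyticOnNhd isOpen_univ
  have hmer : MeromorphicOn (f / h) Set.univ := hanf.meromorphicOn.div hanh.meromorphicOn
  have hne : ∀ z, analyticOrderAt h z ≠ ⊤ := fun z =>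
    hanh.analyticOrderAt_ne_top_of_isPreconnected isPreconnected_univ (Set.mem_univ 0)
      (Set.mem_univ z) (by rw [(hanh 0 trivial).analyticOrderAt_eq_zero.2 hh0]; simp)
  have hzero : ∀ z, meromorphicOrderAt (f / h) z = 0 := by
    intro z
    rw [meromorphicOrderAt_div (hanf z trivial).meromorphicAt (hanh z trivial).meromorphicAt,
      (hanf z trivial).meromorphicOrderAt_eq, (hanh z trivial).meromorphicOrderAt_eq, hord z]
    obtain ⟨n, hn⟩ := ENat.ne_top_iff_exists.1 (hne z)
    rw [← hn]
    simp only [ENat.map_natCast]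
    norm_cast
    simp
  set G := toMeromorphicNFOn (f / h) Set.univ with hGdef
  have hNF : ∀ z, MeromorphicNFAt G z := fun z =>
    meromorphicNFOn_toMeromorphicNFOn (f / h) Set.univ (Set.mem_univ z)
  have hord0 : ∀ z, meromorphicOrderAt G z = 0 := fun z => by
    rw [hGdef, meromorphicOrderAt_toMeromorphicNFOn hmer (Set.mem_univ z), hzero]
  have hGan : ∀ z, AnalyticAt ℂ G z := fun z =>
    (hNF z).meromorphicOrderAt_nonneg_iff_analyticAt.1 (hord0 z).ge
  refine ⟨G, fun z => (hGan z).differentiableAt, fun z =>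
    (hNF z).meromorphicOrderAt_eq_zero_iff.1 (hord0 z), ?_⟩
  have hev : ∀ᶠ z in 𝓝[≠] (0 : ℂ), f z = G z * h z := by
    have h1 := hmer.toMeromorphicNFOn_eq_self_on_nhdsNE (Set.mem_univ (0 : ℂ))
    have h2 : ∀ᶠ z in 𝓝[≠] (0 : ℂ), h z ≠ 0 :=
      nhdsWithin_le_nhds (hh.continuous.continuousAt.eventually_ne hh0)
    filter_upwards [h1, h2] with z hz hz2
    rw [hGdef, hz, Pi.div_apply, div_mul_cancel₀ _ hz2]
  have hGhan : AnalyticOnNhd ℂ (fun z => G z * h z) Set.univ :=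
    fun z _ => (hGan z).mul (hanh z trivial)
  intro z
  exact congrFun (hanf.eq_of_frequently_eq hGhan hev.frequently) z

end ComplexAnalysis

namespace TranslationHMM

/-! ### Exponential integrals and their holomorphy on complex lines -/

section ExponentialIntegrals

/-- All exponential moments of the norm are finite. -/
def HasExpMoments {E : Type*} [NormedAddCommGroup E] [MeasurableSpace E] (ν : Measure E) : Prop :=
  ∀ c : ℝ, Integrable (fun x => Real.exp (c * ‖x‖)) ν

/-- Integrals of exponentials of linearly bounded functions are holomorphic along complex lines. -/
theorem hasDerivAt_integral_cexp {E : Type*} [NormedAddCommGroup E] [MeasurableSpace E]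
    {ν : Measure E} (hν : HasExpMoments ν) {A B : E → ℂ} (hA : Measurable A) (hB : Measurable B)
    {CA CB : ℝ} (hCA : ∀ x, ‖A x‖ ≤ CA * ‖x‖) (hCB : ∀ x, ‖B x‖ ≤ CB * ‖x‖) (w₀ : ℂ) :
    HasDerivAt (fun w : ℂ => ∫ x, Complex.exp (A x + w * B x) ∂ν)
      (∫ x, Complex.exp (A x + w₀ * B x) * B x ∂ν) w₀ := by
  have hexp : ∀ w ∈ Metric.ball w₀ 1, ∀ x, ‖Complex.exp (A x + w * B x)‖
      ≤ Real.exp ((CA + (‖w₀‖ + 1) * CB) * ‖x‖) := by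
    intro w hw x
    rw [Complex.norm_exp, Real.exp_le_exp]
    have hw' : ‖w‖ ≤ ‖w₀‖ + 1 := by
      rw [mem_ball_iff_norm] at hw
      calc ‖w‖ = ‖(w - w₀) + w₀‖ := by simp
        _ ≤ ‖w - w₀‖ + ‖w₀‖ := norm_add_le _ _
        _ ≤ ‖w₀‖ + 1 := by linarith
    calc (A x + w * B x).re ≤ ‖A x + w * B x‖ := Complex.re_le_norm _
      _ ≤ ‖A x‖ + ‖w‖ * ‖B x‖ := (norm_add_le _ _).trans (by rw [norm_mul])
      _ ≤ CA * ‖x‖ + (‖w₀‖ + 1) * (CB * ‖x‖) := by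
        have := hCA x; have := hCB x; gcongr
      _ = _ := by ring
  have hmeas : ∀ w : ℂ, AEStronglyMeasurable (fun x => Complex.exp (A x + w * B x)) ν := fun w =>
    (by fun_prop : Measurable fun x => Complex.exp (A x + w * B x)).aestronglyMeasurable
  refine (hasDerivAt_integral_of_dominated_loc_of_deriv_le
    (F := fun w x => Complex.exp (A x + w * B x))
    (F' := fun w x => Complex.exp (A x + w * B x) * B x)
    (bound := fun x => Real.exp ((CA + (‖w₀‖ + 2) * CB) * ‖x‖))
    (Metric.ball_mem_nhds w₀ one_pos)
    (Filter.Eventually.of_forall hmeas) ?_ ?_ ?_ (hν _) ?_).2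
  · exact (hν _).mono' (hmeas w₀)
      (Filter.Eventually.of_forall (hexp w₀ (Metric.mem_ball_self one_pos)))
  · exact (hmeas w₀).mul hB.aestronglyMeasurable
  · refine Filter.Eventually.of_forall fun x w hw => ?_
    rw [norm_mul]
    have h1 : ‖B x‖ ≤ Real.exp (CB * ‖x‖) :=
      (hCB x).trans ((le_add_of_nonneg_right zero_le_one).trans (Real.add_one_le_exp _))
    calc ‖Complex.exp (A x + w * B x)‖ * ‖B x‖
        ≤ Real.exp ((CA + (‖w₀‖ + 1) * CB) * ‖x‖) * Real.exp (CB * ‖x‖) := by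
          have := hexp w hw x; gcongr
      _ = _ := by rw [← Real.exp_add]; ring_nf
  · refine Filter.Eventually.of_forall fun x w _ => ?_
    have := (((hasDerivAt_id w).mul_const (B x)).const_add (A x)).cexp
    simpa using! this

variable {d : ℕ}

/-- The complex bilinear pairing `zᵀ x` of `z ∈ ℂ^d` and `x ∈ ℝ^d`. -/
def cpair (z : Fin d → ℂ) (x : State d) : ℂ := ∑ j, z j * (x j : ℂ)

/-- The inclusion of `ℝ^d` in `ℂ^d`. -/
def toC (v : State d) : Fin d → ℂ := fun j => (v j : ℂ)

/-- The Laplace transform `z ↦ ∫ exp (zᵀ x) μ(dx)` on `ℂ^d`. -/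
noncomputable def laplace (μ : Measure (State d)) (z : Fin d → ℂ) : ℂ :=
  ∫ x, Complex.exp (cpair z x) ∂μ

theorem Phi_eq (R : Measure (State d × State d)) (z₁ z₂ : Fin d → ℂ) :
    Phi R z₁ z₂ = ∫ x, Complex.exp (cpair z₁ x.1 + cpair z₂ x.2) ∂(R) := rfl

@[fun_prop]
theorem continuous_cpair (z : Fin d → ℂ) : Continuous (cpair z) := by
  unfold cpair; fun_prop

theorem cpair_add_smul (a b : Fin d → ℂ) (w : ℂ) (x : State d) :
    cpair (a + w • b) x = cpair a x + w * cpair b x := by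
  simp only [cpair, Pi.add_apply, Pi.smul_apply, smul_eq_mul, add_mul, Finset.sum_add_distrib,
    Finset.mul_sum, mul_assoc]

theorem cpair_smul (b : Fin d → ℂ) (w : ℂ) (x : State d) : cpair (w • b) x = w * cpair b x := by
  simp only [cpair, Pi.smul_apply, smul_eq_mul, Finset.mul_sum, mul_assoc]

@[simp]
theorem cpair_zero (x : State d) : cpair 0 x = 0 := by simp [cpair]

theorem cpair_toC (v x : State d) : cpair (toC v) x = ((inner ℝ v x : ℝ) : ℂ) := by
  simp only [cpair, toC, PiLp.inner_apply, RCLike.inner_apply, conj_trivial]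
  push_cast
  exact Finset.sum_congr rfl fun j _ => mul_comm _ _

theorem norm_cpair_le (z : Fin d → ℂ) (x : State d) : ‖cpair z x‖ ≤ (∑ j, ‖z j‖) * ‖x‖ := by
  rw [Finset.sum_mul]
  refine (norm_sum_le _ _).trans (Finset.sum_le_sum fun j _ => ?_)
  rw [norm_mul, Complex.norm_real]
  gcongr
  exact PiLp.norm_apply_le x j

theorem differentiable_Phi_line {R : Measure (State d × State d)} (hR : HasExpMoments R)
    (a₁ a₂ b₁ b₂ : Fin d → ℂ) :
    Differentiable ℂ (fun w : ℂ => Phi R (a₁ + w • b₁) (a₂ + w • b₂)) := by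
  have hle : ∀ (z₁ z₂ : Fin d → ℂ) (x : State d × State d),
      ‖cpair z₁ x.1 + cpair z₂ x.2‖ ≤ ((∑ j, ‖z₁ j‖) + ∑ j, ‖z₂ j‖) * ‖x‖ := by
    intro z₁ z₂ x
    rw [add_mul]
    refine (norm_add_le _ _).trans (add_le_add ?_ ?_)
    · refine (norm_cpair_le _ _).trans ?_
      gcongr
      exact norm_fst_le x
    · refine (norm_cpair_le _ _).trans ?_
      gcongr
      exact norm_snd_le x
  intro w
  have h := (hasDerivAt_integral_cexp hR
    (A := fun x => cpair a₁ x.1 + cpair a₂ x.2) (B := fun x => cpair b₁ x.1 + cpair b₂ x.2)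
    (by fun_prop) (by fun_prop) (hle a₁ a₂) (hle b₁ b₂) w).differentiableAt
  refine h.congr_of_eventuallyEq (Filter.Eventually.of_forall fun w => ?_)
  simp only [Phi_eq, cpair_add_smul]
  congr 1
  ext x
  congr 1
  ring

theorem hasDerivAt_laplace_line {μ : Measure (State d)} (hμ : HasExpMoments μ)
    (a b : Fin d → ℂ) (w : ℂ) :
    HasDerivAt (fun w : ℂ => laplace μ (a + w • b))
      (∫ x, Complex.exp (cpair (a + w • b) x) * cpair b x ∂μ) w := by
  have h := hasDerivAt_integral_cexp hμ (A := cpair a) (B := cpair b)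
    (by fun_prop) (by fun_prop) (norm_cpair_le a) (norm_cpair_le b) w
  simpa only [laplace, cpair_add_smul] using h

theorem differentiable_laplace_smul {μ : Measure (State d)} (hμ : HasExpMoments μ)
    (b : Fin d → ℂ) : Differentiable ℂ (fun w : ℂ => laplace μ (w • b)) := fun w => by
  simpa using (hasDerivAt_laplace_line hμ 0 b w).differentiableAt

theorem HasExpMoments.integrable_id {μ : Measure (State d)} (hμ : HasExpMoments μ) :
    Integrable (fun x : State d => x) μ := by
  refine (hμ 1).mono' (by fun_prop) (Filter.Eventually.of_forall fun x => ?_)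
  rw [one_mul]
  linarith [Real.add_one_le_exp ‖x‖]

theorem hasDerivAt_laplace_smul_toC {μ : Measure (State d)} (hμ : HasExpMoments μ) (v : State d) :
    HasDerivAt (fun w : ℂ => laplace μ (w • toC v)) ((inner ℝ v (∫ x, x ∂μ) : ℝ) : ℂ) 0 := by
  have h := hasDerivAt_laplace_line hμ 0 (toC v) 0
  simp only [zero_add, zero_smul, cpair_zero, Complex.exp_zero, one_mul, cpair_toC] at h
  rwa [integral_complex_ofReal, integral_inner hμ.integrable_id] at h

@[simp]
theorem laplace_zero (μ : Measure (State d)) [IsProbabilityMeasure μ] : laplace μ 0 = 1 := by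
  simp [laplace]

theorem Phi_zero_right (R : Measure (State d × State d)) (z : Fin d → ℂ) :
    Phi R z 0 = laplace R.fst z := by
  rw [Phi_eq, laplace, Measure.fst, integral_map (by fun_prop)]
  · simp
  · exact (by fun_prop : Continuous fun x => Complex.exp (cpair z x)).aestronglyMeasurable

theorem charFun_eq_laplace (μ : Measure (State d)) (t : State d) :
    charFun μ t = laplace μ (Complex.I • toC t) := by
  rw [charFun_apply, laplace]
  congr 1
  ext x
  rw [cpair_smul, cpair_toC, real_inner_comm, mul_comm]

theorem integrable_exp_inner {μ : Measure (State d)} {ρ : ℝ} (hμ : μ ∈ expClass d ρ)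
    (u : State d) : Integrable (fun x => Real.exp (inner ℝ u x)) μ := by
  obtain ⟨_, A, B, _, _, h⟩ := hμ
  refine ⟨(by fun_prop : Continuous fun x : State d =>
    Real.exp (inner ℝ u x)).aestronglyMeasurable, ?_⟩
  rw [hasFiniteIntegral_iff_ofReal (Filter.Eventually.of_forall fun x => (Real.exp_pos _).le)]
  exact (h u).trans_lt ENNReal.ofReal_lt_top

/-- The norm is controlled by a single coordinate; the first alternative is there for `d = 0`. -/
theorem norm_le_card_mul_abs (x : State d) : ‖x‖ = 0 ∨ ∃ j, ‖x‖ ≤ d * |x j| := by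
  rcases isEmpty_or_nonempty (Fin d) with hd | hd
  · left
    rw [norm_eq_zero]
    ext j
    exact hd.elim j
  · right
    obtain ⟨j, hj⟩ := Finite.exists_max (fun j => |x j|)
    refine ⟨j, ?_⟩
    have h1 : ‖x‖ ≤ ∑ i, |x i| := by
      conv_lhs => rw [← (EuclideanSpace.basisFun (Fin d) ℝ).sum_repr x]
      refine (norm_sum_le _ _).trans (le_of_eq ?_)
      simp [norm_smul]
    refine h1.trans ((Finset.sum_le_sum fun i _ => hj i).trans ?_)
    simp

theorem hasExpMoments_of_mem_expClass {μ : Measure (State d)} {ρ : ℝ} (hμ : μ ∈ expClass d ρ) :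
    HasExpMoments μ := by
  have hfin : IsFiniteMeasure μ := hμ.1
  intro c
  set e : Fin d → State d := fun j => EuclideanSpace.single j 1 with he
  have hint : Integrable (fun x : State d => 1 + ∑ j, (Real.exp (inner ℝ ((|c| * d) • e j) x)
      + Real.exp (inner ℝ ((-(|c| * d)) • e j) x))) μ :=
    (integrable_const _).add (integrable_finsetSum _ fun j _ =>
      (integrable_exp_inner hμ _).add (integrable_exp_inner hμ _))
  refine hint.mono' (by fun_prop : Continuous fun x : State d =>
    Real.exp (c * ‖x‖)).aestronglyMeasurable (Filter.Eventually.of_forall fun x => ?_)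
  rw [Real.norm_of_nonneg (Real.exp_pos _).le]
  have hnn : ∀ j ∈ Finset.univ, 0 ≤ Real.exp (inner ℝ ((|c| * d) • e j) x)
      + Real.exp (inner ℝ ((-(|c| * d)) • e j) x) := fun j _ => by positivity
  rcases norm_le_card_mul_abs x with h0 | ⟨j, hj⟩
  · have := Finset.sum_nonneg hnn
    simp only [h0, mul_zero, Real.exp_zero]
    linarith
  · have h1 := Finset.single_le_sum hnn (Finset.mem_univ j)
    refine le_trans ?_ (h1.trans (le_add_of_nonneg_left zero_le_one))
    have h2 : c * ‖x‖ ≤ |c| * d * |x j| := by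
      rw [mul_assoc]
      exact (mul_le_mul_of_nonneg_right (le_abs_self c) (norm_nonneg _)).trans (by gcongr)
    have h3 : ∀ s : ℝ, inner ℝ (s • e j) x = s * x j := by
      intro s
      simp [he, inner_smul_left, EuclideanSpace.inner_single_left]
    rw [h3, h3]
    rcases abs_cases (x j) with ⟨h, _⟩ | ⟨h, _⟩ <;> rw [h] at h2
    · exact (Real.exp_le_exp.2 h2).trans (le_add_of_nonneg_right (Real.exp_pos _).le)
    · refine (Real.exp_le_exp.2 (h2.trans (le_of_eq ?_))).trans
        (le_add_of_nonneg_left (Real.exp_pos _).le)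
      ring

theorem hasExpMoments_prod {R : Measure (State d × State d)} [IsFiniteMeasure R]
    (h₁ : HasExpMoments R.fst) (h₂ : HasExpMoments R.snd) : HasExpMoments R := by
  intro c
  have hi₁ : Integrable (fun x : State d × State d => Real.exp (|c| * ‖x.1‖)) R :=
    (h₁ |c|).comp_measurable measurable_fst
  have hi₂ : Integrable (fun x : State d × State d => Real.exp (|c| * ‖x.2‖)) R :=
    (h₂ |c|).comp_measurable measurable_snd
  refine (hi₁.add hi₂).mono' (by fun_prop) (Filter.Eventually.of_forall fun x => ?_)
  rw [Real.norm_of_nonneg (Real.exp_pos _).le]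
  have hc : Real.exp (c * ‖x‖) ≤ Real.exp (|c| * ‖x‖) :=
    Real.exp_le_exp.2 (mul_le_mul_of_nonneg_right (le_abs_self c) (norm_nonneg _))
  refine hc.trans ?_
  rcases max_choice ‖x.1‖ ‖x.2‖ with h | h <;> rw [Prod.norm_def, h]
  · exact le_add_of_nonneg_right (Real.exp_pos _).le
  · exact le_add_of_nonneg_left (Real.exp_pos _).le

/-- Along the complexification of a real line, a Laplace transform of a measure of `expClass d ρ` is
an entire function of order at most `ρ`. -/
theorem exists_norm_laplace_smul_le {μ : Measure (State d)} {ρ : ℝ} (hρ : 0 < ρ)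
    (hμ : μ ∈ expClass d ρ) (v : State d) :
    ∃ A B : ℝ, 0 ≤ B ∧ ∀ w : ℂ, ‖laplace μ (w • toC v)‖ ≤ A * Real.exp (B * ‖w‖ ^ ρ) := by
  have hμ' := hμ
  obtain ⟨_, A, B, hA, hB, h⟩ := hμ'
  refine ⟨A, B * ‖v‖ ^ ρ, by positivity, fun w => ?_⟩
  have h1 : ‖laplace μ (w • toC v)‖ ≤ ∫ x, Real.exp (inner ℝ (w.re • v) x) ∂μ := by
    refine (norm_integral_le_integral_norm _).trans (le_of_eq ?_)
    congr 1
    ext x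
    rw [Complex.norm_exp, cpair_smul, cpair_toC, Complex.re_mul_ofReal, real_inner_smul_left]
  have h2 : ∫ x, Real.exp (inner ℝ (w.re • v) x) ∂μ
      ≤ A * Real.exp (B * ‖w.re • v‖ ^ ρ) := by
    rw [integral_eq_lintegral_of_nonneg_ae
      (Filter.Eventually.of_forall fun x => (Real.exp_pos _).le)
      (integrable_exp_inner hμ _).aestronglyMeasurable]
    exact ENNReal.toReal_le_of_le_ofReal (by positivity) (h _)
  refine h1.trans (h2.trans ?_)
  gcongr A * Real.exp ?_
  rw [mul_assoc]
  gcongr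
  rw [norm_smul, Real.mul_rpow (norm_nonneg _) (norm_nonneg _), mul_comm]
  gcongr
  exact Complex.abs_re_le_norm w

end ExponentialIntegrals

/-! ### The law of two consecutive observations -/

section Laws

variable {d : ℕ}

theorem chainLaw_map_eval_zero (K : Kernel (State d) (State d)) [IsMarkovKernel K]
    (μ : Measure (State d)) [IsProbabilityMeasure μ] :
    (chainLaw K μ).map (fun x => x 0) = μ := by
  have h : (chainLaw K μ).map (Preorder.frestrictLe (π := fun _ => State d) 0)
      = μ.map (MeasurableEquiv.piUnique (fun _ : Finset.Iic 0 => State d)).symm := by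
    rw [chainLaw, Kernel.trajMeasure, Measure.map_comp _ _ (by fun_prop),
      Kernel.traj_map_frestrictLe, Kernel.partialTraj_self, Measure.id_comp]
  have e : (chainLaw K μ).map (fun x => x 0)
      = ((chainLaw K μ).map (Preorder.frestrictLe (π := fun _ => State d) 0)).map
        (fun p => p ⟨0, Finset.mem_Iic.2 le_rfl⟩) := by
    rw [Measure.map_map (by fun_prop) (by fun_prop)]
    rfl
  rw [e, h, Measure.map_map (by fun_prop) (by fun_prop)]
  exact Measure.map_id

/-- The first two states of the chain have law `pairLaw`. -/
theorem chainLaw_map_eval_zero_one (K : Kernel (State d) (State d)) [IsMarkovKernel K]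
    (μ : Measure (State d)) [IsProbabilityMeasure μ] :
    (chainLaw K μ).map (fun x => (x 0, x 1)) = pairLaw K μ := by
  have h := Kernel.map_frestrictLe_trajMeasure_compProd_eq_map_trajMeasure
    (X := fun _ => State d) (μ₀ := μ) (a := 0) (κ := fun n => K.comap
      (fun x : (i : Finset.Iic n) → State d => x ⟨n, Finset.mem_Iic.2 le_rfl⟩)
      (measurable_pi_apply _))
  have h0 := chainLaw_map_eval_zero K μ
  change _ = (chainLaw K μ).map _ at h
  change ((chainLaw K μ).map (Preorder.frestrictLe 0)) ⊗ₘ _ = _ at h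
  have e : (chainLaw K μ).map (fun x => (x 0, x 1))
      = ((chainLaw K μ).map (fun x =>
          (Preorder.frestrictLe (π := fun _ => State d) 0 x, x (0 + 1)))).map
        (fun p => (p.1 ⟨0, Finset.mem_Iic.2 le_rfl⟩, p.2)) := by
    rw [Measure.map_map (by fun_prop) (by fun_prop)]
    rfl
  rw [e, ← h]
  have h0' : ((chainLaw K μ).map (Preorder.frestrictLe (π := fun _ => State d) 0)).map
      (fun p => p ⟨0, Finset.mem_Iic.2 le_rfl⟩) = μ := by
    rw [Measure.map_map (by fun_prop) (by fun_prop)]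
    exact h0
  have : IsProbabilityMeasure (chainLaw K μ) := by unfold chainLaw; infer_instance
  ext s hs
  rw [Measure.map_apply (by fun_prop) hs, pairLaw, Measure.compProd_apply hs,
    Measure.compProd_apply (hs.preimage (by fun_prop))]
  conv_rhs => rw [← h0']
  rw [lintegral_map (Kernel.measurable_kernel_prodMk_left hs) (by fun_prop)]
  rfl

theorem fst_pairLaw (K : Kernel (State d) (State d)) [IsMarkovKernel K]
    (μ : Measure (State d)) [SFinite μ] : (pairLaw K μ).fst = μ :=
  Measure.fst_compProd μ K

theorem snd_pairLaw {K : Kernel (State d) (State d)} [IsMarkovKernel K]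
    {μ : Measure (State d)} [SFinite μ] (h : Kernel.Invariant K μ) : (pairLaw K μ).snd = μ := by
  rw [pairLaw, Measure.snd_compProd]
  exact h

/-- The characteristic function of two consecutive observations is that of the states times that of
the noise. -/
theorem integral_obsLaw_cexp (K : Kernel (State d) (State d)) [IsMarkovKernel K]
    (μ : Measure (State d)) [IsProbabilityMeasure μ] (P : Measure (State d))
    [IsProbabilityMeasure P] (t₁ t₂ : State d) :
    ∫ y, Complex.exp (cpair (Complex.I • toC t₁) (y 0) + cpair (Complex.I • toC t₂) (y 1))
        ∂(obsLaw K μ P)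
      = Phi (pairLaw K μ) (Complex.I • toC t₁) (Complex.I • toC t₂)
        * (charFun P t₁ * charFun P t₂) := by
  set z₁ := Complex.I • toC t₁
  set z₂ := Complex.I • toC t₂
  have : IsProbabilityMeasure (chainLaw K μ) := by unfold chainLaw; infer_instance
  have hadd : ∀ (z : Fin d → ℂ) (x y : State d), cpair z (x + y) = cpair z x + cpair z y := by
    intro z x y
    simp [cpair, mul_add, Finset.sum_add_distrib]
  have hc : Continuous fun p : State d × State d => Complex.exp (cpair z₁ p.1 + cpair z₂ p.2) := by
    fun_prop
  have hc' : Continuous fun y : ℕ → State d => Complex.exp (cpair z₁ (y 0) + cpair z₂ (y 1)) := by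
    fun_prop
  rw [obsLaw, integral_map (by fun_prop) hc'.aestronglyMeasurable]
  have hsplit : ∀ p : (ℕ → State d) × (ℕ → State d),
      Complex.exp (cpair z₁ (p.1 0 + p.2 0) + cpair z₂ (p.1 1 + p.2 1))
        = Complex.exp (cpair z₁ (p.1 0) + cpair z₂ (p.1 1))
          * Complex.exp (cpair z₁ (p.2 0) + cpair z₂ (p.2 1)) := by
    intro p
    rw [hadd, hadd, ← Complex.exp_add]
    congr 1
    ring
  simp only [hsplit]
  rw [integral_prod_mul (fun x : ℕ → State d => Complex.exp (cpair z₁ (x 0) + cpair z₂ (x 1)))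
    (fun x : ℕ → State d => Complex.exp (cpair z₁ (x 0) + cpair z₂ (x 1)))]
  congr 1
  · rw [Phi_eq, ← chainLaw_map_eval_zero_one K μ, integral_map (by fun_prop)
      hc.aestronglyMeasurable]
  · have hp := Measure.infinitePi_map_eval_prod (P := fun _ : ℕ => P) (i := 0) (j := 1) (by simp)
    rw [charFun_eq_laplace, charFun_eq_laplace, laplace, laplace, ← integral_prod_mul, ← hp,
      integral_map (by fun_prop)]
    · simp only [Complex.exp_add]; rfl
    · simp only [← Complex.exp_add]
      exact hc.aestronglyMeasurable

end Laws

/-! ### Identification of the translation -/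

section Identification

open Filter Topology

variable {d : ℕ}

/-- Identity theorem: an entire function vanishing near the origin on a real line is zero. -/
theorem eq_zero_of_eventually_real_line {g : ℂ → ℂ} (hg : Differentiable ℂ g) {c : ℂ} (hc : c ≠ 0)
    (h : ∀ᶠ s : ℝ in 𝓝[≠] 0, g (c * s) = 0) (w : ℂ) : g w = 0 := by
  have han : AnalyticOnNhd ℂ g Set.univ := hg.differentiableOn.analyticOnNhd isOpen_univ
  have ht : Tendsto (fun s : ℝ => c * (s : ℂ)) (𝓝[≠] 0) (𝓝[≠] 0) := by
    refine tendsto_nhdsWithin_of_tendsto_nhds_of_eventually_within _ ?_ ?_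
    · have : Continuous fun s : ℝ => c * (s : ℂ) := by fun_prop
      simpa using (this.tendsto 0).mono_left nhdsWithin_le_nhds
    · filter_upwards [self_mem_nhdsWithin] with s hs
      simpa [hc] using hs
  have hfr : ∃ᶠ z in 𝓝[≠] (0 : ℂ), g z = 0 := ht.frequently h.frequently
  exact congrFun (han.eq_of_frequently_eq (g := fun _ => 0) analyticOnNhd_const hfr) w

theorem toC_add_smul (x y : State d) (s : ℝ) : toC (x + s • y) = toC x + (s : ℂ) • toC y := by
  ext j; simp [toC]

theorem toC_smul (y : State d) (s : ℝ) : toC (s • y) = (s : ℂ) • toC y := by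
  ext j; simp [toC]

theorem exists_toC_add_I_smul (z : Fin d → ℂ) : ∃ x y : State d, z = toC x + Complex.I • toC y :=
  ⟨WithLp.toLp 2 fun j => (z j).re, WithLp.toLp 2 fun j => (z j).im, by
    ext j
    simp only [toC, Pi.add_apply, Pi.smul_apply, smul_eq_mul]
    rw [mul_comm]
    exact (Complex.re_add_im (z j)).symm⟩

/-- A function on `ℂ^d × ℂ^d` that is entire on complex lines and vanishes on imaginary vectors near
the origin is zero. Two applications of the one-variable identity theorem suffice: the first, on
lines through the origin, reaches the real vectors, and the second, on the lines through
`x + w y` with `x` and `y` real, reaches all vectors. -/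
theorem eq_zero_of_differentiable_lines {D : (Fin d → ℂ) → (Fin d → ℂ) → ℂ}
    (hline : ∀ a₁ a₂ b₁ b₂, Differentiable ℂ (fun w : ℂ => D (a₁ + w • b₁) (a₂ + w • b₂)))
    (hev : ∀ t₁ t₂ : State d, ∀ᶠ s : ℝ in 𝓝 0,
      D (Complex.I • toC (s • t₁)) (Complex.I • toC (s • t₂)) = 0)
    (z₁ z₂ : Fin d → ℂ) : D z₁ z₂ = 0 := by
  have hreal : ∀ t₁ t₂ : State d, D (toC t₁) (toC t₂) = 0 := by
    intro t₁ t₂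
    have h := eq_zero_of_eventually_real_line (hline 0 0 (toC t₁) (toC t₂)) Complex.I_ne_zero
      (by
        filter_upwards [nhdsWithin_le_nhds (hev t₁ t₂)] with s hs
        simpa only [zero_add, mul_smul, ← toC_smul] using hs) 1
    simpa using h
  obtain ⟨x₁, y₁, rfl⟩ := exists_toC_add_I_smul z₁
  obtain ⟨x₂, y₂, rfl⟩ := exists_toC_add_I_smul z₂
  refine eq_zero_of_eventually_real_line (hline (toC x₁) (toC x₂) (toC y₁) (toC y₂)) one_ne_zero
    (Eventually.of_forall fun s => ?_) Complex.I
  rw [one_mul, ← toC_add_smul, ← toC_add_smul]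
  exact hreal _ _

theorem exists_ne_zero_of_entire {f g k : ℂ → ℂ} (hf : Continuous f) (hg : Continuous g)
    (hk : Differentiable ℂ k) (hf0 : f 0 ≠ 0) (hg0 : g 0 ≠ 0) {c : ℂ} (hkc : k c ≠ 0) :
    ∃ s, f s ≠ 0 ∧ g s ≠ 0 ∧ k s ≠ 0 := by
  by_contra! hcon
  have han : AnalyticOnNhd ℂ k Set.univ := hk.differentiableOn.analyticOnNhd isOpen_univ
  have hev : ∀ᶠ s in 𝓝[≠] (0 : ℂ), k s = 0 := by
    filter_upwards [nhdsWithin_le_nhds (hf.continuousAt.eventually_ne hf0),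
      nhdsWithin_le_nhds (hg.continuousAt.eventually_ne hg0)] with s h1 h2
    exact hcon s h1 h2
  exact hkc (congrFun (han.eq_of_frequently_eq (g := fun _ => 0) analyticOnNhd_const
    hev.frequently) c)

theorem analyticOrderAt_le_of_mul_eq_mul {f h F₁ F₂ : ℂ → ℂ} (hf : Differentiable ℂ f)
    (hh : Differentiable ℂ h) (hF₁ : Differentiable ℂ F₁) (hF₂ : Differentiable ℂ F₂) {z : ℂ}
    (hz : F₂ z ≠ 0) (heq : ∀ w, F₁ w * h w = F₂ w * f w) :
    analyticOrderAt h z ≤ analyticOrderAt f z := by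
  have e : F₁ * h = F₂ * f := funext heq
  have h1 := analyticOrderAt_mul (hF₁.analyticAt z) (hh.analyticAt z)
  have h2 := analyticOrderAt_mul (hF₂.analyticAt z) (hf.analyticAt z)
  rw [(hF₂.analyticAt z).analyticOrderAt_eq_zero.2 hz, zero_add] at h2
  rw [← h2, ← e, h1]
  exact le_add_self

/-- The dependency assumption compares multiplicities of zeros: at a zero `z₀` of `laplace μ'`, freeze
the other variable of the identity `hid` at a point where `Phi R'` at `z₀` and both Laplace
transforms do not vanish; then `laplace μ'` divides `laplace μ` near `z₀`. -/
theorem analyticOrderAt_laplace_le {R R' : Measure (State d × State d)} {μ μ' : Measure (State d)}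
    [IsProbabilityMeasure μ] [IsProbabilityMeasure μ']
    (hR : HasExpMoments R) (hR' : HasExpMoments R') (hμ : HasExpMoments μ)
    (hμ' : HasExpMoments μ') (hdep : DependencyAssumption R')
    (hid : ∀ z₁ z₂, Phi R z₁ z₂ * (laplace μ' z₁ * laplace μ' z₂)
      = Phi R' z₁ z₂ * (laplace μ z₁ * laplace μ z₂)) (b : Fin d → ℂ) (w₀ : ℂ) :
    analyticOrderAt (fun w : ℂ => laplace μ' (w • b)) w₀
      ≤ analyticOrderAt (fun w : ℂ => laplace μ (w • b)) w₀ := by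
  have hd := differentiable_laplace_smul hμ
  have hd' := differentiable_laplace_smul hμ'
  rcases hdep (w₀ • b) with hne | hne
  · obtain ⟨z, hz⟩ := Function.ne_iff.1 hne
    obtain ⟨s, h1, h2, h3⟩ := exists_ne_zero_of_entire (hd z).continuous (hd' z).continuous
      (differentiable_Phi_line hR' (w₀ • b) 0 0 z) (by simp) (by simp) (c := 1) (by simpa using hz)
    simp only [smul_zero, add_zero, zero_add] at h3
    refine analyticOrderAt_le_of_mul_eq_mul (hd b) (hd' b)
      (F₁ := fun w => Phi R (w • b) (s • z) * laplace μ' (s • z))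
      (F₂ := fun w => Phi R' (w • b) (s • z) * laplace μ (s • z)) ?_ ?_ (mul_ne_zero h3 h1) ?_
    · have := differentiable_Phi_line hR 0 (s • z) b 0
      simp only [smul_zero, add_zero, zero_add] at this
      exact this.mul_const _
    · have := differentiable_Phi_line hR' 0 (s • z) b 0
      simp only [smul_zero, add_zero, zero_add] at this
      exact this.mul_const _
    · intro w
      linear_combination hid (w • b) (s • z)
  · obtain ⟨z, hz⟩ := Function.ne_iff.1 hne
    obtain ⟨s, h1, h2, h3⟩ := exists_ne_zero_of_entire (hd z).continuous (hd' z).continuous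
      (differentiable_Phi_line hR' 0 (w₀ • b) z 0) (by simp) (by simp) (c := 1) (by simpa using hz)
    simp only [smul_zero, add_zero, zero_add] at h3
    refine analyticOrderAt_le_of_mul_eq_mul (hd b) (hd' b)
      (F₁ := fun w => Phi R (s • z) (w • b) * laplace μ' (s • z))
      (F₂ := fun w => Phi R' (s • z) (w • b) * laplace μ (s • z)) ?_ ?_ (mul_ne_zero h3 h1) ?_
    · have := differentiable_Phi_line hR (s • z) 0 0 b
      simp only [smul_zero, add_zero, zero_add] at this
      exact this.mul_const _
    · have := differentiable_Phi_line hR' (s • z) 0 0 b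
      simp only [smul_zero, add_zero, zero_add] at this
      exact this.mul_const _
    · intro w
      linear_combination hid (s • z) (w • b)

/-- The exponent is found by comparing derivatives at the origin, which shows that it depends linearly
on the direction `v`, through the difference of the means. -/
theorem laplace_smul_eq_exp_mul {μ μ' : Measure (State d)} [IsProbabilityMeasure μ]
    [IsProbabilityMeasure μ'] {ρ : ℝ} (hρ0 : 0 < ρ) (hρ2 : ρ < 2) (hμ : μ ∈ expClass d ρ)
    (hμ' : μ' ∈ expClass d ρ) (v : State d)
    (hord : ∀ w₀, analyticOrderAt (fun w : ℂ => laplace μ (w • toC v)) w₀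
      = analyticOrderAt (fun w : ℂ => laplace μ' (w • toC v)) w₀) (w : ℂ) :
    laplace μ (w • toC v)
      = Complex.exp (w * cpair (toC v) (∫ x, x ∂μ - ∫ x, x ∂μ')) * laplace μ' (w • toC v) := by
  have hm := hasExpMoments_of_mem_expClass hμ
  have hm' := hasExpMoments_of_mem_expClass hμ'
  have hd := differentiable_laplace_smul hm (toC v)
  have hd' := differentiable_laplace_smul hm' (toC v)
  obtain ⟨G, hG, hG0, hfac⟩ := exists_entire_factor hd hd' (by simp) hord
  obtain ⟨A, B, hB, hAB⟩ := exists_norm_laplace_smul_le hρ0 hμ v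
  obtain ⟨A', B', hB', hAB'⟩ := exists_norm_laplace_smul_le hρ0 hμ' v
  obtain ⟨a, ha⟩ := exists_eq_exp_mul_of_factor hd hd' hG hG0 (by simp) (by simp) hfac
    (A := max |A| |A'|) (B := max B B') hρ2 (le_max_of_le_left hB)
    (fun z => (hAB z).trans (by
      gcongr
      · exact (le_abs_self A).trans (le_max_left _ _)
      · exact le_max_left _ _))
    (fun z => (hAB' z).trans (by
      gcongr
      · exact (le_abs_self A').trans (le_max_right _ _)
      · exact le_max_right _ _))
  have hder := hasDerivAt_laplace_smul_toC hm v
  have hder' := hasDerivAt_laplace_smul_toC hm' v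
  have hexp : HasDerivAt (fun w : ℂ => Complex.exp (a * w)) a 0 := by
    simpa using! ((hasDerivAt_id (0 : ℂ)).const_mul a).cexp
  have hprod := hexp.mul hder'
  have hder2 := hprod.congr_of_eventuallyEq (Eventually.of_forall ha)
  have hval := hder.unique hder2
  have haeq : a = cpair (toC v) (∫ x, x ∂μ - ∫ x, x ∂μ') := by
    rw [cpair_toC, inner_sub_right]
    push_cast
    rw [hval]
    simp
  rw [ha w, haeq, mul_comm w]

theorem cpair_sub_right (z : Fin d → ℂ) (x y : State d) :
    cpair z (x - y) = cpair z x - cpair z y := by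
  simp [cpair, mul_sub, Finset.sum_sub_distrib]

/-- Uniqueness of characteristic functions, for measures on `ℝ^d × ℝ^d`. -/
theorem ext_of_Phi_imaginary {R R' : Measure (State d × State d)} [IsFiniteMeasure R]
    [IsFiniteMeasure R'] (h : ∀ t₁ t₂ : State d, Phi R (Complex.I • toC t₁) (Complex.I • toC t₂)
      = Phi R' (Complex.I • toC t₁) (Complex.I • toC t₂)) : R = R' := by
  refine Measure.ext_of_charFunDual ?_
  ext L
  set t₁ := (InnerProductSpace.toDual ℝ (State d)).symm
    (L.comp (ContinuousLinearMap.inl ℝ (State d) (State d)))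
  set t₂ := (InnerProductSpace.toDual ℝ (State d)).symm
    (L.comp (ContinuousLinearMap.inr ℝ (State d) (State d)))
  have hL : ∀ x : State d × State d, ((L x : ℝ) : ℂ) * Complex.I
      = cpair (Complex.I • toC t₁) x.1 + cpair (Complex.I • toC t₂) x.2 := by
    intro x
    rw [cpair_smul, cpair_smul, cpair_toC, cpair_toC, InnerProductSpace.toDual_symm_apply,
      InnerProductSpace.toDual_symm_apply, ← mul_add, mul_comm, ← Complex.ofReal_add]
    congr 2
    simp [← map_add]
  have := h t₁ t₂
  simpa only [charFunDual_apply, hL, Phi_eq] using this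

theorem Phi_map_sub (R : Measure (State d × State d)) (m : State d) (z₁ z₂ : Fin d → ℂ) :
    Phi (R.map (fun x => (x.1 - m, x.2 - m))) z₁ z₂
      = Complex.exp (-(cpair z₁ m + cpair z₂ m)) * Phi R z₁ z₂ := by
  rw [Phi_eq, Phi_eq, integral_map (by fun_prop)]
  · rw [← integral_const_mul]
    congr 1
    ext x
    rw [← Complex.exp_add, cpair_sub_right, cpair_sub_right]
    congr 1
    ring
  · exact (by fun_prop : Continuous fun x : State d × State d =>
      Complex.exp (cpair z₁ x.1 + cpair z₂ x.2)).aestronglyMeasurable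

/-- Elimination of the noise: the identity holds on imaginary vectors near the origin, where the
characteristic function of `P` does not vanish, and extends to all complex vectors because the noise
no longer occurs in it. -/
theorem Phi_mul_laplace_eq {R R' : Measure (State d × State d)}
    {μ μ' P P' : Measure (State d)} [IsProbabilityMeasure P] [IsProbabilityMeasure P']
    (hR : HasExpMoments R) (hR' : HasExpMoments R') (hμ : HasExpMoments μ) (hμ' : HasExpMoments μ')
    (hobs₁ : ∀ t, laplace μ (Complex.I • toC t) * charFun P t
      = laplace μ' (Complex.I • toC t) * charFun P' t)
    (hobs : ∀ t₁ t₂, Phi R (Complex.I • toC t₁) (Complex.I • toC t₂)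
        * (charFun P t₁ * charFun P t₂)
      = Phi R' (Complex.I • toC t₁) (Complex.I • toC t₂) * (charFun P' t₁ * charFun P' t₂))
    (z₁ z₂ : Fin d → ℂ) :
    Phi R z₁ z₂ * (laplace μ' z₁ * laplace μ' z₂)
      = Phi R' z₁ z₂ * (laplace μ z₁ * laplace μ z₂) := by
  refine sub_eq_zero.1 (eq_zero_of_differentiable_lines (D := fun z₁ z₂ =>
    Phi R z₁ z₂ * (laplace μ' z₁ * laplace μ' z₂) - Phi R' z₁ z₂ * (laplace μ z₁ * laplace μ z₂))
    ?_ ?_ z₁ z₂)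
  · intro a₁ a₂ b₁ b₂
    have hl : ∀ {ν : Measure (State d)}, HasExpMoments ν → ∀ a b,
        Differentiable ℂ fun w : ℂ => laplace ν (a + w • b) :=
      fun hν a b w => (hasDerivAt_laplace_line hν a b w).differentiableAt
    exact ((differentiable_Phi_line hR _ _ _ _).mul ((hl hμ' _ _).mul (hl hμ' _ _))).sub
      ((differentiable_Phi_line hR' _ _ _ _).mul ((hl hμ _ _).mul (hl hμ _ _)))
  · intro t₁ t₂
    have hcont : ∀ t : State d, ∀ᶠ s : ℝ in 𝓝 0, charFun P (s • t) ≠ 0 := by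
      intro t
      have hc : Continuous fun s : ℝ => charFun P (s • t) :=
        continuous_charFun.comp (by fun_prop)
      exact hc.continuousAt.eventually_ne (by simp)
    filter_upwards [hcont t₁, hcont t₂] with s h1 h2
    have e := hobs (s • t₁) (s • t₂)
    have e1 := hobs₁ (s • t₁)
    have e2 := hobs₁ (s • t₂)
    generalize Complex.I • toC (s • t₁) = y₁ at *
    generalize Complex.I • toC (s • t₂) = y₂ at *
    refine (mul_eq_zero.1 (?_ : (charFun P (s • t₁) * charFun P (s • t₂)) * _ = 0)).resolve_left
      (mul_ne_zero h1 h2)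
    linear_combination (laplace μ' y₁ * laplace μ' y₂) * e
      - Phi R' y₁ y₂ * laplace μ y₂ * charFun P (s • t₂) * e1
      - Phi R' y₁ y₂ * laplace μ' y₁ * charFun P' (s • t₁) * e2

/-- The translation is by the difference of the means of the two stationary distributions. -/
theorem eqUpToTranslation_of_charFun {R R' : Measure (State d × State d)}
    [IsProbabilityMeasure R] [IsProbabilityMeasure R'] {μ μ' : Measure (State d)}
    (hfst : R.fst = μ) (hsnd : R.snd = μ) (hfst' : R'.fst = μ') (hsnd' : R'.snd = μ')
    (hdep : DependencyAssumption R) (hdep' : DependencyAssumption R')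
    {ρ : ℝ} (hρ0 : 0 < ρ) (hρ2 : ρ < 2) (hμ : μ ∈ expClass d ρ) (hμ' : μ' ∈ expClass d ρ)
    {P P' : Measure (State d)} [IsProbabilityMeasure P] [IsProbabilityMeasure P']
    (hobs : ∀ t₁ t₂, Phi R (Complex.I • toC t₁) (Complex.I • toC t₂)
        * (charFun P t₁ * charFun P t₂)
      = Phi R' (Complex.I • toC t₁) (Complex.I • toC t₂) * (charFun P' t₁ * charFun P' t₂)) :
    EqUpToTranslation R R' P P' := by
  have : IsProbabilityMeasure μ := by rw [← hfst]; infer_instance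
  have : IsProbabilityMeasure μ' := by rw [← hfst']; infer_instance
  have hm := hasExpMoments_of_mem_expClass hμ
  have hm' := hasExpMoments_of_mem_expClass hμ'
  have hRm : HasExpMoments R := hasExpMoments_prod (hfst ▸ hm) (hsnd ▸ hm)
  have hRm' : HasExpMoments R' := hasExpMoments_prod (hfst' ▸ hm') (hsnd' ▸ hm')
  -- the law of a single observation
  have hobs₁ : ∀ t, laplace μ (Complex.I • toC t) * charFun P t
      = laplace μ' (Complex.I • toC t) * charFun P' t := by
    intro t
    have h := hobs t 0
    have h0 : toC (0 : State d) = 0 := by ext; simp [toC]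
    simpa [h0, Phi_zero_right, hfst, hfst'] using h
  have hid := Phi_mul_laplace_eq hRm hRm' hm hm' hobs₁ hobs
  have hexp : ∀ (v : State d) (w : ℂ), laplace μ (w • toC v)
      = Complex.exp (w * cpair (toC v) (∫ x, x ∂μ - ∫ x, x ∂μ')) * laplace μ' (w • toC v) :=
    fun v => laplace_smul_eq_exp_mul hρ0 hρ2 hμ hμ' v fun w₀ =>
      le_antisymm (analyticOrderAt_laplace_le hRm' hRm hm' hm hdep
        (fun z₁ z₂ => (hid z₁ z₂).symm) _ _)
        (analyticOrderAt_laplace_le hRm hRm' hm hm' hdep' hid _ _)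
  set m := ∫ x, x ∂μ - ∫ x, x ∂μ' with hmdef
  refine ⟨m, ?_, ?_⟩
  · have : IsProbabilityMeasure (R.map (fun x => (x.1 - m, x.2 - m))) :=
      Measure.isProbabilityMeasure_map (by fun_prop)
    refine ext_of_Phi_imaginary fun t₁ t₂ => ?_
    rw [Phi_map_sub]
    -- along the complex line through `(t₁, t₂)` the two sides agree near the origin
    have hz := differentiable_laplace_smul hm'
    have hev : ∀ᶠ w : ℂ in 𝓝 0, Phi R (w • toC t₁) (w • toC t₂)
        = Complex.exp (w * (cpair (toC t₁) m + cpair (toC t₂) m))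
          * Phi R' (w • toC t₁) (w • toC t₂) := by
      filter_upwards [(hz (toC t₁)).continuous.continuousAt.eventually_ne (x := 0)
          (by simp : laplace μ' ((0 : ℂ) • toC t₁) ≠ 0),
        (hz (toC t₂)).continuous.continuousAt.eventually_ne (x := 0)
          (by simp : laplace μ' ((0 : ℂ) • toC t₂) ≠ 0)] with w h1 h2
      have e := hid (w • toC t₁) (w • toC t₂)
      rw [hexp t₁ w, hexp t₂ w] at e
      refine mul_right_cancel₀ (mul_ne_zero h1 h2) (e.trans ?_)
      rw [mul_add, Complex.exp_add]
      ring
    have hd1 := differentiable_Phi_line hRm 0 0 (toC t₁) (toC t₂)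
    have hd2 := differentiable_Phi_line hRm' 0 0 (toC t₁) (toC t₂)
    simp only [zero_add] at hd1 hd2
    have hd3 : Differentiable ℂ fun w : ℂ =>
        Complex.exp (w * (cpair (toC t₁) m + cpair (toC t₂) m))
          * Phi R' (w • toC t₁) (w • toC t₂) :=
      Differentiable.mul (by fun_prop) hd2
    have hfin := congrFun ((hd1.differentiableOn.analyticOnNhd isOpen_univ).eq_of_eventuallyEq
      (hd3.differentiableOn.analyticOnNhd isOpen_univ) hev) Complex.I
    rw [hfin, cpair_smul, cpair_smul, ← mul_assoc, ← Complex.exp_add]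
    ring_nf
    simp
  · have hP : P.map (fun e => e + m) = P' := by
      have : IsProbabilityMeasure (P.map (fun e => e + m)) :=
        Measure.isProbabilityMeasure_map (by fun_prop)
      refine Measure.ext_of_charFun ?_
      ext t
      rw [charFun_map_add_const]
      -- `laplace μ'` may vanish at `I t`, but not at `I s t` for `s ≠ 1` close to `1`;
      -- the equality at `s = 1` follows by continuity
      have hcP : Continuous fun s : ℝ => charFun P (s • t)
          * Complex.exp (((inner ℝ m (s • t) : ℝ) : ℂ) * Complex.I) :=
        (continuous_charFun.comp (by fun_prop)).mul (by fun_prop)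
      have hcP' : Continuous fun s : ℝ => charFun P' (s • t) :=
        continuous_charFun.comp (by fun_prop)
      have hne : ∀ᶠ s : ℝ in 𝓝[≠] 1, laplace μ' ((Complex.I * s) • toC t) ≠ 0 := by
        have hd := differentiable_laplace_smul hm' (toC t)
        have han := hd.differentiableOn.analyticOnNhd isOpen_univ
        have ht : Tendsto (fun s : ℝ => Complex.I * (s : ℂ)) (𝓝[≠] 1) (𝓝[≠] Complex.I) := by
          refine tendsto_nhdsWithin_of_tendsto_nhds_of_eventually_within _ ?_ ?_
          · have : Continuous fun s : ℝ => Complex.I * (s : ℂ) := by fun_prop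
            simpa using (this.tendsto 1).mono_left nhdsWithin_le_nhds
          · filter_upwards [self_mem_nhdsWithin] with s hs
            simpa using hs
        refine ht.eventually (p := fun w : ℂ => laplace μ' (w • toC t) ≠ 0) ?_
        rcases (han Complex.I trivial).eventually_eq_zero_or_eventually_ne_zero with h | h
        · have h0 := congrFun (han.eq_of_eventuallyEq (g := fun _ => 0) analyticOnNhd_const h) 0
          simp at h0
        · exact h
      have hev : ∀ᶠ s : ℝ in 𝓝[≠] 1, charFun P (s • t)
          * Complex.exp (((inner ℝ m (s • t) : ℝ) : ℂ) * Complex.I) = charFun P' (s • t) := by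
        filter_upwards [hne] with s hs
        have e := hobs₁ (s • t)
        rw [toC_smul, smul_smul, hexp t] at e
        refine mul_left_cancel₀ hs (Eq.trans ?_ e)
        rw [cpair_toC, real_inner_smul_right, real_inner_comm]
        push_cast
        ring_nf
      have hl1 := (hcP.tendsto 1).mono_left (nhdsWithin_le_nhds (s := {1}ᶜ))
      have hl2 := (hcP'.tendsto 1).mono_left (nhdsWithin_le_nhds (s := {1}ᶜ))
      simpa using tendsto_nhds_unique_of_eventuallyEq hl1 hl2 hev
    have := Measure.map_prod_map P P (f := fun e => e + m) (g := fun e => e + m)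
      (by fun_prop) (by fun_prop)
    rw [hP] at this
    exact this.symm

end Identification

end TranslationHMM

theorem theorem1 (d : ℕ)
    (K K' : Kernel (TranslationHMM.State d) (TranslationHMM.State d))
    [IsMarkovKernel K] [IsMarkovKernel K']
    (μ μ' : Measure (TranslationHMM.State d))
    (hμ : TranslationHMM.IsUniqueStationary K μ)
    (hμ' : TranslationHMM.IsUniqueStationary K' μ')
    (hR : TranslationHMM.DependencyAssumption (TranslationHMM.pairLaw K μ))
    (hR' : TranslationHMM.DependencyAssumption (TranslationHMM.pairLaw K' μ'))
    (hρ : ∃ ρ : ℝ, 0 < ρ ∧ ρ < 2 ∧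
      μ ∈ TranslationHMM.expClass d ρ ∧ μ' ∈ TranslationHMM.expClass d ρ)
    (P P' : Measure (TranslationHMM.State d))
    [IsProbabilityMeasure P] [IsProbabilityMeasure P']
    (hobs : TranslationHMM.obsLaw K μ P = TranslationHMM.obsLaw K' μ' P') :
    TranslationHMM.EqUpToTranslation
      (TranslationHMM.pairLaw K μ) (TranslationHMM.pairLaw K' μ') P P' := by
  obtain ⟨hprob, hinv, -⟩ := hμ
  obtain ⟨hprob', hinv', -⟩ := hμ'
  obtain ⟨ρ, hρ0, hρ2, hexp, hexp'⟩ := hρ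
  have : IsProbabilityMeasure (TranslationHMM.pairLaw K μ) := by
    unfold TranslationHMM.pairLaw; infer_instance
  have : IsProbabilityMeasure (TranslationHMM.pairLaw K' μ') := by
    unfold TranslationHMM.pairLaw; infer_instance
  refine TranslationHMM.eqUpToTranslation_of_charFun (TranslationHMM.fst_pairLaw K μ)
    (TranslationHMM.snd_pairLaw hinv) (TranslationHMM.fst_pairLaw K' μ')
    (TranslationHMM.snd_pairLaw hinv') hR hR' hρ0 hρ2 hexp hexp' fun t₁ t₂ => ?_
  rw [← TranslationHMM.integral_obsLaw_cexp, ← TranslationHMM.integral_obsLaw_cexp, hobs]
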